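/- Let $\mathcal V$ be a finite-dimensional complex Hilbert space, $M$ a finite set, $M'\subset M$, $\{\rho_m\}_{m\in M}$ density operators on $\mathcal V$, and $p$ a probability distribution on $M$; put $p(M')=\sum_{m\in M'}p(m)$. Let $\Pi$ and $\Pi_m$ ($m\in M$) be orthogonal projections onto subspaces of $\mathcal V$. Suppose that there are constants $\epsilon\in(0,1)$, $D>0$, $d>0$ such that $\mathrm{tr}(\Pi)\le D$ and, for all $m\in M'$, \[\mathrm{tr}(\rho_m\Pi)\ge 1-\epsilon,\qquad \mathrm{tr}(\rho_m\Pi_m)\ge 1-\epsilon,\qquad \Pi_m\rho_m\Pi_m\le \tfrac1d\,\Pi_m .\] Put $\omega=\sum_{m\in M'}p(m)\rho_m$, let $L\ge 1$ be an integer, and let $X_1,\dots,X_L$ be independent random variables with values in $M$, each with distribution $p$. Then \[\Pr\Bigl(\Bigl\|\frac1L\sum_{i=1}^{L}\Pi\,\Pi_{X_i}\,\rho_{X_i}\,\Pi_{X_i}\,\Pi-\omega\Bigr\|_1\le 1-p(M')+4\sqrt{1-p(M')}+42\,\epsilon^{1/8}\Bigr)\ \ge\ 1-2D\exp\Bigl(-p(M')\,\frac{\epsilon^3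 L d}{(2\ln 2)\,D}\Bigr),\] where $\|A\|_1=\mathrm{tr}\sqrt{A^\dagger A}$ is the trace norm and $\exp$ is the natural exponential. -/

import Mathlib

open MeasureTheory ProbabilityTheory

noncomputable section

namespace QCover

variable {V : Type*} [NormedAddCommGroup V] [InnerProductSpace ℂ V]

/-- The trace of an operator on a finite-dimensional complex Hilbert space. -/
def trace (A : V →L[ℂ] V) : ℂ := LinearMap.trace ℂ V (A : V →ₗ[ℂ] V)

/-- The trace norm `‖A‖₁ = tr |A|`, where `|A| = √(A† A)`.  The trace of `|A|` is a nonnegative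
real number, so taking the real part only changes the type. -/
def traceNorm [CompleteSpace V] (A : V →L[ℂ] V) : ℝ := (trace (CFC.abs A)).re

/-- Density operators (quantum states): positive semidefinite operators of trace one. The order
is the Loewner order. -/
def IsState (ρ : V →L[ℂ] V) : Prop := 0 ≤ ρ ∧ trace ρ = 1

end QCover

end

/-!
The operator-valued average is controlled directly in trace norm: a second-moment bound for its
mean, and McDiarmid's bounded differences inequality for the deviation from the mean.

Write `Y m = Q Π_m ρ_m Π_m Q` and let `f(x)` be the trace-norm distance of `L⁻¹ ∑ Y (x i)` from
`ω = ∑_{m ∈ M'} p m ρ_m`. The mean of `f` under independent sampling has three contributions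
(`iidExp_traceNorm_cutDown_le`).

* The samples outside `M'` contribute their expected fraction `1 - p(M')`.
* The samples inside `M'` fluctuate around their mean. Both are supported on the range of `Q`, so
  the trace norm is at most `√(tr Q)` times the Hilbert–Schmidt norm, and independence together
  with `tr (Y m)² ≤ 1 / d` bounds the mean fluctuation by `√(D / (d L))`
  (`iidExp_traceNorm_sub_le`).
* Gentle measurement, applied to both projections, bounds the distance of the mean from `ω` by
  `4 √ε` (`traceNorm_cutDown_sub_le`).

Replacing one sample changes `f` by at most `2 / L`, so `f` exceeds its mean by `t` with
probability at most `exp (-t² L / 8)` (`one_sub_exp_le_measureReal_le`).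

Let `s = ε ^ (1 / 8)` and `a = L d / D`. If `42 s ≥ 2` or `M'` is empty, the claimed radius
dominates `f` everywhere. Otherwise `s` is small; one has `D ≥ 1 - ε`, and flatness forces
`d ≤ 2 D` (`one_sub_le_trace_div`). If `a s² < 1`, the exponent, at most `ε³ a = s²⁴ a`, is so
small that the claimed lower bound on the probability is not positive. If `a s² ≥ 1`, the mean
fluctuation is at most `s`, and the deviation inequality with `t = s` gives more than the claim,
because `L ≥ a / 2` and `s² L / 8` dominates `s²⁴ a`.
-/

/-! ### Trace and trace norm of self-adjoint operators -/

namespace QCover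

section Trace

variable {V : Type*} [NormedAddCommGroup V] [InnerProductSpace ℂ V]

local notation "⟪" x ", " y "⟫" => inner ℂ x y

lemma trace_add (A B : V →L[ℂ] V) : trace (A + B) = trace A + trace B := by
  simp [trace]

lemma trace_sub (A B : V →L[ℂ] V) : trace (A - B) = trace A - trace B := by
  simp [trace]

lemma trace_smul (c : ℂ) (A : V →L[ℂ] V) : trace (c • A) = c * trace A := by
  simp [trace]

lemma trace_sum {ι : Type*} (s : Finset ι) (A : ι → V →L[ℂ] V) :
    trace (∑ i ∈ s, A i) = ∑ i ∈ s, trace (A i) := by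
  simp [trace]

lemma trace_mul_comm (A B : V →L[ℂ] V) : trace (A * B) = trace (B * A) :=
  LinearMap.trace_mul_comm ℂ (A : V →ₗ[ℂ] V) (B : V →ₗ[ℂ] V)

lemma re_trace_eq_sum {ι : Type*} [Fintype ι] (b : OrthonormalBasis ι ℂ V) (A : V →L[ℂ] V) :
    (trace A).re = ∑ i, (⟪b i, A (b i)⟫).re := by
  rw [trace, LinearMap.trace_eq_sum_inner _ b, Complex.re_sum]
  rfl

lemma inner_nonneg_of_nonneg {A : V →L[ℂ] V} (hA : 0 ≤ A) (x : V) : 0 ≤ (⟪x, A x⟫).re :=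
  ((ContinuousLinearMap.nonneg_iff_isPositive A).1 hA).re_inner_nonneg_right x

lemma re_trace_nonneg [FiniteDimensional ℂ V] {A : V →L[ℂ] V} (hA : 0 ≤ A) : 0 ≤ (trace A).re := by
  rw [re_trace_eq_sum (stdOrthonormalBasis ℂ V)]
  exact Finset.sum_nonneg fun i _ => inner_nonneg_of_nonneg hA _

variable [CompleteSpace V]

lemma re_trace_star_mul_self {ι : Type*} [Fintype ι] (b : OrthonormalBasis ι ℂ V)
    (A : V →L[ℂ] V) : (trace (star A * A)).re = ∑ i, ‖A (b i)‖ ^ 2 := by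
  rw [re_trace_eq_sum b]
  refine Finset.sum_congr rfl fun i _ => ?_
  rw [ContinuousLinearMap.star_eq_adjoint, mul_apply_eq_comp,
    ContinuousLinearMap.adjoint_inner_right]
  exact inner_self_eq_norm_sq (𝕜 := ℂ) _

lemma inner_apply_of_isSelfAdjoint {A : V →L[ℂ] V} (hA : IsSelfAdjoint A) (x y : V) :
    ⟪x, A y⟫ = ⟪A x, y⟫ := by
  rw [← ContinuousLinearMap.adjoint_inner_left, ← ContinuousLinearMap.star_eq_adjoint, hA.star_eq]

/-- Cauchy–Schwarz for the Hilbert–Schmidt inner product, with the absolute values inside the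
sum over an orthonormal basis. -/
lemma sum_abs_inner_le {ι : Type*} [Fintype ι] (b : OrthonormalBasis ι ℂ V)
    (A B : V →L[ℂ] V) :
    ∑ i, |(⟪A (b i), B (b i)⟫).re| ≤
      √(trace (star A * A)).re * √(trace (star B * B)).re := by
  rw [re_trace_star_mul_self b, re_trace_star_mul_self b]
  refine le_trans (Finset.sum_le_sum fun i _ => ?_)
    (Real.sum_mul_le_sqrt_mul_sqrt Finset.univ (fun i => ‖A (b i)‖) fun i => ‖B (b i)‖)
  exact (Complex.abs_re_le_norm _).trans (norm_inner_le_norm _ _)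

/-- The diagonal entries of a self-adjoint operator in any orthonormal basis bound its trace norm
from below. -/
lemma sum_abs_inner_le_traceNorm {ι : Type*} [Fintype ι] (b : OrthonormalBasis ι ℂ V)
    {A : V →L[ℂ] V} (hA : IsSelfAdjoint A) :
    ∑ i, |(⟪b i, A (b i)⟫).re| ≤ traceNorm A := by
  rw [traceNorm, re_trace_eq_sum b]
  refine Finset.sum_le_sum fun i _ => ?_
  have h1 : 0 ≤ CFC.abs A - A := by
    rw [CFC.abs_sub_self A hA]
    exact nsmul_nonneg (CFC.negPart_nonneg A) 2
  have h2 : 0 ≤ CFC.abs A + A := by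
    rw [CFC.abs_add_self A hA]
    exact nsmul_nonneg (CFC.posPart_nonneg A) 2
  have h1' := inner_nonneg_of_nonneg h1 (b i)
  have h2' := inner_nonneg_of_nonneg h2 (b i)
  simp only [sub_apply, add_apply, inner_sub_right,
    inner_add_right, Complex.sub_re, Complex.add_re] at h1' h2'
  rw [abs_le]
  constructor <;> linarith

lemma traceNorm_neg (A : V →L[ℂ] V) : traceNorm (-A) = traceNorm A := by
  rw [traceNorm, CFC.abs_neg, traceNorm]

lemma traceNorm_of_nonneg {A : V →L[ℂ] V} (hA : 0 ≤ A) : traceNorm A = (trace A).re := by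
  rw [traceNorm, CFC.abs_of_nonneg A hA]

lemma traceNorm_real_smul {c : ℝ} (hc : 0 ≤ c) (A : V →L[ℂ] V) :
    traceNorm ((c : ℂ) • A) = c * traceNorm A := by
  have h : CFC.abs ((c : ℂ) • A) = (c : ℂ) • CFC.abs A := by
    rw [CFC.abs_smul]
    simp [abs_of_nonneg hc]
  rw [traceNorm, h, trace_smul, Complex.re_ofReal_mul, traceNorm]

lemma isSelfAdjoint_real_smul (c : ℝ) {A : V →L[ℂ] V} (hA : IsSelfAdjoint A) :
    IsSelfAdjoint ((c : ℂ) • A) := by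
  rw [IsSelfAdjoint, star_smul, hA.star_eq]
  simp

lemma nonneg_conj {E A : V →L[ℂ] V} (hE : IsStarProjection E) (hA : 0 ≤ A) : 0 ≤ E * A * E := by
  simpa [hE.isSelfAdjoint.star_eq] using star_left_conjugate_nonneg hA E

lemma trace_conj {E : V →L[ℂ] V} (hE : IsStarProjection E) (A : V →L[ℂ] V) :
    trace (E * A * E) = trace (A * E) := by
  rw [mul_assoc, trace_mul_comm, mul_assoc, hE.isIdempotentElem.eq]

lemma isSelfAdjoint_conj {E A : V →L[ℂ] V} (hE : IsStarProjection E) (hA : IsSelfAdjoint A) :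
    IsSelfAdjoint (E * A * E) := by
  simpa [hE.isSelfAdjoint.star_eq] using hA.conjugate E

lemma smul_le_smul_one {E : V →L[ℂ] V} (hE : IsStarProjection E) {c : ℝ} (hc : 0 ≤ c) :
    (c : ℂ) • E ≤ (c : ℂ) • 1 := by
  rw [← sub_nonneg, ← smul_sub, Complex.coe_smul]
  exact smul_nonneg hc hE.one_sub_nonneg

/-- Compressing `A ≤ c • 1` by a projection keeps the bound. -/
lemma conj_le_smul_one {E A : V →L[ℂ] V} (hE : IsStarProjection E) {c : ℝ} (hc : 0 ≤ c)
    (hA : A ≤ (c : ℂ) • 1) : E * A * E ≤ (c : ℂ) • 1 := by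
  refine le_trans ?_ (smul_le_smul_one hE hc)
  have := nonneg_conj hE (sub_nonneg.2 hA)
  rw [← sub_nonneg]
  have e : (c : ℂ) • E - E * A * E = E * ((c : ℂ) • 1 - A) * E := by
    simp [mul_sub, sub_mul, hE.isIdempotentElem.eq]
  rwa [e]

variable [FiniteDimensional ℂ V]

/-- An eigenbasis of a self-adjoint operator attains its trace norm. -/
lemma exists_traceNorm_le_sum {A : V →L[ℂ] V} (hA : IsSelfAdjoint A) :
    ∃ b : OrthonormalBasis (Fin (Module.finrank ℂ V)) ℂ V,
      traceNorm A ≤ ∑ i, |(⟪b i, A (b i)⟫).re| := by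
  have hs : (A : V →ₗ[ℂ] V).IsSymmetric := hA.isSymmetric
  let b := hs.eigenvectorBasis rfl
  refine ⟨b, ?_⟩
  rw [traceNorm, re_trace_eq_sum b]
  refine Finset.sum_le_sum fun i _ => ?_
  have hb : A (b i) = (hs.eigenvalues rfl i : ℂ) • b i := hs.apply_eigenvectorBasis rfl i
  have hn : ‖b i‖ = 1 := b.norm_eq_one i
  -- `|A|² = A²` for self-adjoint `A`.
  have h1 : ‖CFC.abs A (b i)‖ = ‖A (b i)‖ := by
    have h : ‖CFC.abs A (b i)‖ ^ 2 = ‖A (b i)‖ ^ 2 := by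
      rw [← inner_self_eq_norm_sq (𝕜 := ℂ), ← inner_self_eq_norm_sq (𝕜 := ℂ),
        ← inner_apply_of_isSelfAdjoint (CFC.abs_nonneg A).isSelfAdjoint,
        ← inner_apply_of_isSelfAdjoint hA, ← mul_apply_eq_comp,
        ← mul_apply_eq_comp, CFC.abs_mul_abs, hA.star_eq]
    exact (sq_eq_sq₀ (norm_nonneg _) (norm_nonneg _)).1 h
  calc (⟪b i, CFC.abs A (b i)⟫).re ≤ ‖⟪b i, CFC.abs A (b i)⟫‖ := Complex.re_le_norm _
    _ ≤ ‖b i‖ * ‖CFC.abs A (b i)‖ := norm_inner_le_norm _ _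
    _ = |(⟪b i, A (b i)⟫).re| := by
      rw [h1, hb, norm_smul, inner_smul_right, inner_self_eq_norm_sq_to_K, hn]
      simp

lemma traceNorm_add_le {A B : V →L[ℂ] V} (hA : IsSelfAdjoint A) (hB : IsSelfAdjoint B) :
    traceNorm (A + B) ≤ traceNorm A + traceNorm B := by
  obtain ⟨b, hb⟩ := exists_traceNorm_le_sum (hA.add hB)
  refine hb.trans ?_
  refine le_trans ?_ (add_le_add (sum_abs_inner_le_traceNorm b hA)
    (sum_abs_inner_le_traceNorm b hB))
  rw [← Finset.sum_add_distrib]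
  refine Finset.sum_le_sum fun i _ => ?_
  rw [add_apply, inner_add_right, Complex.add_re]
  exact abs_add_le _ _

lemma traceNorm_sub_le {A B : V →L[ℂ] V} (hA : IsSelfAdjoint A) (hB : IsSelfAdjoint B) :
    traceNorm (A - B) ≤ traceNorm A + traceNorm B := by
  rw [sub_eq_add_neg, ← traceNorm_neg B]
  exact traceNorm_add_le hA hB.neg

lemma traceNorm_sum_le {ι : Type*} (s : Finset ι) {A : ι → V →L[ℂ] V}
    (hA : ∀ i, IsSelfAdjoint (A i)) :
    traceNorm (∑ i ∈ s, A i) ≤ ∑ i ∈ s, traceNorm (A i) := by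
  classical
  induction s using Finset.induction_on with
  | empty => simp [traceNorm, trace]
  | insert a s ha ih =>
    rw [Finset.sum_insert ha, Finset.sum_insert ha]
    exact (traceNorm_add_le (hA a) (isSelfAdjoint_sum s fun i _ => hA i)).trans (by linarith)

/-- The trace of a product of two positive operators is nonnegative. -/
lemma re_trace_mul_nonneg {A B : V →L[ℂ] V} (hA : 0 ≤ A) (hB : 0 ≤ B) :
    0 ≤ (trace (A * B)).re := by
  have hs : CFC.sqrt A * CFC.sqrt A = A := CFC.sqrt_mul_sqrt_self A hA
  have hsa : star (CFC.sqrt A) = CFC.sqrt A := (CFC.sqrt_nonneg A).isSelfAdjoint.star_eq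
  have h : trace (A * B) = trace (star (CFC.sqrt A) * B * CFC.sqrt A) := by
    rw [hsa]
    conv_lhs => rw [← hs, mul_assoc, trace_mul_comm]
  rw [h]
  exact re_trace_nonneg (star_left_conjugate_nonneg hB _)

lemma re_trace_mul_mono {A B C : V →L[ℂ] V} (hC : 0 ≤ C) (h : A ≤ B) :
    (trace (C * A)).re ≤ (trace (C * B)).re := by
  have := re_trace_mul_nonneg hC (sub_nonneg.2 h)
  rw [mul_sub, trace_sub, Complex.sub_re] at this
  linarith

lemma re_trace_conj_le {E A : V →L[ℂ] V} (hE : IsStarProjection E) (hA : 0 ≤ A) :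
    (trace (E * A * E)).re ≤ (trace A).re := by
  rw [trace_conj hE]
  simpa using re_trace_mul_mono hA hE.le_one

/-- Compression by a projection does not increase the trace norm. -/
lemma traceNorm_conj_le {E A : V →L[ℂ] V} (hE : IsStarProjection E) (hA : IsSelfAdjoint A) :
    traceNorm (E * A * E) ≤ traceNorm A := by
  have hp := CFC.posPart_nonneg A
  have hn := CFC.negPart_nonneg A
  have hdec : E * A * E = E * A⁺ * E - E * A⁻ * E := by
    rw [← sub_mul, ← mul_sub, CFC.posPart_sub_negPart A hA]
  rw [hdec]
  refine (traceNorm_sub_le (nonneg_conj hE hp).isSelfAdjoint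
    (nonneg_conj hE hn).isSelfAdjoint).trans ?_
  rw [traceNorm_of_nonneg (nonneg_conj hE hp), traceNorm_of_nonneg (nonneg_conj hE hn),
    traceNorm, ← CFC.posPart_add_negPart A hA, trace_add, Complex.add_re]
  exact add_le_add (re_trace_conj_le hE hp) (re_trace_conj_le hE hn)

/-- Gentle measurement: a projection of probability at least `1 - ε` moves the state by at most
`2 √ε` in trace norm. -/
lemma traceNorm_sub_conj_le {ρ E : V →L[ℂ] V} (hρ : IsState ρ) (hE : IsStarProjection E) {ε : ℝ}
    (h : 1 - ε ≤ (trace (ρ * E)).re) : traceNorm (ρ - E * ρ * E) ≤ 2 * √ε := by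
  obtain ⟨hρ0, hρ1⟩ := hρ
  have hEsa := hE.isSelfAdjoint
  have hF := hE.one_sub
  set F := 1 - E with hFdef
  set S := CFC.sqrt ρ with hS
  have hSS : S * S = ρ := CFC.sqrt_mul_sqrt_self ρ hρ0
  have hSsa : IsSelfAdjoint S := (CFC.sqrt_nonneg ρ).isSelfAdjoint
  have key : ∀ G : V →L[ℂ] V, IsStarProjection G →
      (trace (star (S * G) * (S * G))).re = (trace (ρ * G)).re := by
    intro G hG
    rw [star_mul, hG.isSelfAdjoint.star_eq, hSsa.star_eq, ← trace_conj hG]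
    congr 2
    simp only [← hSS, mul_assoc]
  have hFt : (trace (ρ * F)).re ≤ ε := by
    rw [hFdef, mul_sub, mul_one, trace_sub, hρ1, Complex.sub_re, Complex.one_re]
    linarith
  have hone : (trace (star (S * 1) * (S * 1))).re = 1 := by
    rw [key 1 (.one _), mul_one, hρ1, Complex.one_re]
  have hEt : (trace (ρ * E)).re ≤ 1 := by
    have := re_trace_mul_mono hρ0 hE.le_one
    rwa [mul_one, hρ1, Complex.one_re] at this
  obtain ⟨b, hb⟩ := exists_traceNorm_le_sum
    (hρ0.isSelfAdjoint.sub (isSelfAdjoint_conj hE hρ0.isSelfAdjoint))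
  refine hb.trans ?_
  -- With `F = 1 - E`, `ρ - E ρ E = F ρ + E ρ F`; each term splits as `(√ρ ·)† (√ρ ·)`, with a
  -- factor `√ρ F` of Hilbert–Schmidt norm at most `√ε`.
  have hdec : ∀ x : V, ⟪x, (ρ - E * ρ * E) x⟫ =
      ⟪(S * F) x, (S * 1) x⟫ + ⟪(S * E) x, (S * F) x⟫ := by
    intro x
    have e1 : ρ - E * ρ * E = F * (S * S) + E * S * (S * F) := by
      rw [hSS, mul_assoc E S, ← mul_assoc S S, hSS, hFdef]
      noncomm_ring
    rw [e1]
    simp only [add_apply, mul_apply_eq_comp, inner_add_right,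
      inner_apply_of_isSelfAdjoint hSsa, inner_apply_of_isSelfAdjoint hEsa,
      inner_apply_of_isSelfAdjoint hF.isSelfAdjoint, one_apply_eq_self]
  have h1 := sum_abs_inner_le b (S * F) (S * 1)
  have h2 := sum_abs_inner_le b (S * E) (S * F)
  rw [hone, key F hF, Real.sqrt_one, mul_one (√(trace (ρ * F)).re)] at h1
  rw [key F hF, key E hE] at h2
  have h3 : √(trace (ρ * F)).re ≤ √ε := Real.sqrt_le_sqrt hFt
  have h4 : √(trace (ρ * E)).re ≤ 1 := Real.sqrt_le_one.2 hEt
  calc ∑ i, |(⟪b i, (ρ - E * ρ * E) (b i)⟫).re|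
      ≤ ∑ i, (|(⟪(S * F) (b i), (S * 1) (b i)⟫).re| + |(⟪(S * E) (b i), (S * F) (b i)⟫).re|) := by
        refine Finset.sum_le_sum fun i _ => ?_
        rw [hdec, Complex.add_re]
        exact abs_add_le _ _
    _ ≤ √ε + 1 * √ε := by
        rw [Finset.sum_add_distrib]
        exact add_le_add (h1.trans h3)
          (h2.trans (mul_le_mul h4 h3 (Real.sqrt_nonneg _) zero_le_one))
    _ = 2 * √ε := by ring

/-- A state is dominated by the identity. -/
lemma IsState.le_one {ρ : V →L[ℂ] V} (hρ : IsState ρ) : ρ ≤ 1 := by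
  have hS := (CFC.sqrt_nonneg ρ).isSelfAdjoint
  have hSS : CFC.sqrt ρ * CFC.sqrt ρ = ρ := CFC.sqrt_mul_sqrt_self ρ hρ.1
  set S := CFC.sqrt ρ
  set b := stdOrthonormalBasis ℂ V
  -- The norm of `√ρ` is at most its Hilbert–Schmidt norm, which is one.
  rw [ContinuousLinearMap.le_def, ContinuousLinearMap.isPositive_def']
  refine ⟨(IsSelfAdjoint.one _).sub hρ.1.isSelfAdjoint, fun x => ?_⟩
  have hx : (⟪ρ x, x⟫).re = ‖S x‖ ^ 2 := by
    rw [← hSS, mul_apply_eq_comp, ← inner_apply_of_isSelfAdjoint hS]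
    exact inner_self_eq_norm_sq (𝕜 := ℂ) _
  have hle : ‖S x‖ ^ 2 ≤ ‖x‖ ^ 2 := by
    calc ‖S x‖ ^ 2 = ∑ i, ‖⟪b i, S x⟫‖ ^ 2 := (b.sum_sq_norm_inner_right _).symm
      _ = ∑ i, ‖⟪S (b i), x⟫‖ ^ 2 := by simp only [inner_apply_of_isSelfAdjoint hS]
      _ ≤ ∑ i, ‖S (b i)‖ ^ 2 * ‖x‖ ^ 2 := Finset.sum_le_sum fun i _ => by
          rw [← mul_pow]
          gcongr
          exact norm_inner_le_norm _ _
      _ = ‖x‖ ^ 2 := by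
          rw [← Finset.sum_mul, ← re_trace_star_mul_self b, hS.star_eq, hSS, hρ.2,
            Complex.one_re, one_mul]
  have h1 : (⟪x, x⟫).re = ‖x‖ ^ 2 := inner_self_eq_norm_sq (𝕜 := ℂ) x
  rw [ContinuousLinearMap.reApplyInnerSelf_apply, sub_apply, one_apply_eq_self, inner_sub_left]
  change 0 ≤ (⟪x, x⟫ - ⟪ρ x, x⟫).re
  rw [Complex.sub_re, h1, hx]
  linarith

/-- A self-adjoint operator supported on the range of a projection has trace norm at most the
square root of the rank times its Hilbert–Schmidt norm. -/
lemma traceNorm_le_sqrt_mul_sqrt {E B : V →L[ℂ] V} (hE : IsStarProjection E)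
    (hB : IsSelfAdjoint B) (hEB : E * B = B) :
    traceNorm B ≤ √(trace E).re * √(trace (star B * B)).re := by
  obtain ⟨b, hb⟩ := exists_traceNorm_le_sum hB
  refine hb.trans ?_
  have h := sum_abs_inner_le b E B
  rw [hE.isSelfAdjoint.star_eq, hE.isIdempotentElem.eq] at h
  refine le_trans (le_of_eq (Finset.sum_congr rfl fun i _ => ?_)) h
  conv_lhs => rw [← hEB, mul_apply_eq_comp,
    inner_apply_of_isSelfAdjoint hE.isSelfAdjoint]

/-- A positive operator of trace at most one and norm at most `c` has squared Hilbert–Schmidt norm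
at most `c`. -/
lemma re_trace_star_mul_self_le {A : V →L[ℂ] V} (hA : 0 ≤ A) {c : ℝ} (hc : 0 ≤ c)
    (hAc : A ≤ (c : ℂ) • 1) (hA1 : (trace A).re ≤ 1) : (trace (star A * A)).re ≤ c := by
  rw [hA.isSelfAdjoint.star_eq]
  refine (re_trace_mul_mono hA hAc).trans ?_
  rw [mul_smul_comm, mul_one, trace_smul, Complex.re_ofReal_mul]
  nlinarith

end Trace

/-! ### Independent sampling from a finite distribution -/

section IID

variable {M : Type*} [Fintype M]

/-- The expectation of `f` over `n` independent samples from the weights `p` on a finite set. -/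
noncomputable def iidExp (p : M → ℝ) {E : Type*} [AddCommMonoid E] [Module ℝ E] {n : ℕ}
    (f : (Fin n → M) → E) : E :=
  ∑ x, (∏ i, p (x i)) • f x

lemma iidExp_zero (p : M → ℝ) {E : Type*} [AddCommMonoid E] [Module ℝ E]
    (f : (Fin 0 → M) → E) : iidExp p f = f Fin.elim0 := by
  rw [iidExp, Fintype.sum_unique]
  simp only [Finset.univ_eq_empty, Finset.prod_empty, one_smul]
  exact congrArg f (Subsingleton.elim _ _)

lemma iidExp_succ (p : M → ℝ) {E : Type*} [AddCommMonoid E] [Module ℝ E] {n : ℕ}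
    (f : (Fin (n + 1) → M) → E) :
    iidExp p f = ∑ m, p m • iidExp p fun y : Fin n → M => f (Fin.cons m y) := by
  simp only [iidExp]
  rw [← (Fin.consEquiv fun _ : Fin (n + 1) => M).sum_comp, Fintype.sum_prod_type]
  refine Finset.sum_congr rfl fun m _ => ?_
  rw [Finset.smul_sum]
  refine Finset.sum_congr rfl fun y _ => ?_
  simp [Fin.consEquiv, Fin.prod_univ_succ, mul_smul]

lemma iidExp_add (p : M → ℝ) {n : ℕ} (f g : (Fin n → M) → ℝ) :
    (iidExp p fun x => f x + g x) = iidExp p f + iidExp p g := by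
  simp [iidExp, mul_add, Finset.sum_add_distrib]

lemma iidExp_sub (p : M → ℝ) {n : ℕ} (f g : (Fin n → M) → ℝ) :
    (iidExp p fun x => f x - g x) = iidExp p f - iidExp p g := by
  simp [iidExp, mul_sub, Finset.sum_sub_distrib]

lemma iidExp_const_mul (p : M → ℝ) {n : ℕ} (c : ℝ) (f : (Fin n → M) → ℝ) :
    (iidExp p fun x => c * f x) = c * iidExp p f := by
  simp only [iidExp, Finset.mul_sum, smul_eq_mul]
  exact Finset.sum_congr rfl fun x _ => by ring

lemma iidExp_sum (p : M → ℝ) {n : ℕ} {ι : Type*} (s : Finset ι) (f : ι → (Fin n → M) → ℝ) :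
    (iidExp p fun x => ∑ i ∈ s, f i x) = ∑ i ∈ s, iidExp p (f i) := by
  simp only [iidExp, Finset.smul_sum]
  exact Finset.sum_comm

variable {p : M → ℝ}

lemma iidExp_mono (hp : p ∈ stdSimplex ℝ M) {n : ℕ} {f g : (Fin n → M) → ℝ}
    (h : ∀ x, f x ≤ g x) : iidExp p f ≤ iidExp p g :=
  Finset.sum_le_sum fun x _ =>
    mul_le_mul_of_nonneg_left (h x) (Finset.prod_nonneg fun i _ => hp.1 (x i))

lemma iidExp_const (hp : p ∈ stdSimplex ℝ M) (n : ℕ) (c : ℝ) :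
    (iidExp p fun _ : Fin n → M => c) = c := by
  induction n with
  | zero => rw [iidExp_zero]
  | succ n ih => rw [iidExp_succ, ih, ← Finset.sum_smul, hp.2, one_smul]

lemma iidExp_sum_apply (hp : p ∈ stdSimplex ℝ M) (g : M → ℝ) (n : ℕ) :
    (iidExp p fun x : Fin n → M => ∑ i, g (x i)) = n * ∑ m, p m * g m := by
  induction n with
  | zero => simp [iidExp_zero]
  | succ n ih =>
    rw [iidExp_succ]
    simp only [Fin.sum_univ_succ, Fin.cons_zero, Fin.cons_succ, iidExp_add, ih,
      iidExp_const hp, smul_eq_mul, mul_add, Finset.sum_add_distrib, ← Finset.sum_mul, hp.2]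
    push_cast
    ring

lemma iidExp_le_sqrt (hp : p ∈ stdSimplex ℝ M) {n : ℕ} {f : (Fin n → M) → ℝ}
    (hf : ∀ x, 0 ≤ f x) : iidExp p f ≤ √(iidExp p fun x => f x ^ 2) := by
  apply Real.le_sqrt_of_sq_le
  have h1 : ∑ x : Fin n → M, ∏ i, p (x i) = 1 := by
    simpa [iidExp] using iidExp_const hp n 1
  exact Real.pow_arith_mean_le_arith_mean_pow Finset.univ _ _
    (fun x _ => Finset.prod_nonneg fun i _ => hp.1 (x i)) h1 (fun x _ => hf x) 2

/-- The variance of a sum of independent centred vectors is the sum of the variances. -/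
lemma iidExp_norm_sum_sq (hp : p ∈ stdSimplex ℝ M) {E : Type*} [NormedAddCommGroup E]
    [InnerProductSpace ℝ E] (Z : M → E) (hZ : ∑ m, p m • Z m = 0) (n : ℕ) :
    (iidExp p fun x : Fin n → M => ‖∑ i, Z (x i)‖ ^ 2) = n * ∑ m, p m * ‖Z m‖ ^ 2 := by
  induction n with
  | zero => simp [iidExp_zero]
  | succ n ih =>
    have cross : ∑ m, p m * (iidExp p fun y : Fin n → M => 2 * inner ℝ (Z m) (∑ i, Z (y i)))
        = 0 := by
      have : ∀ m, p m * (iidExp p fun y : Fin n → M => 2 * inner ℝ (Z m) (∑ i, Z (y i)))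
          = iidExp p fun y : Fin n → M => 2 * inner ℝ (p m • Z m) (∑ i, Z (y i)) := by
        intro m
        rw [← iidExp_const_mul]
        congr 1
        funext y
        rw [real_inner_smul_left]
        ring
      simp only [this]
      rw [← iidExp_sum]
      simp only [← Finset.mul_sum, ← sum_inner, hZ, inner_zero_left, mul_zero]
      exact iidExp_const hp n 0
    rw [iidExp_succ]
    simp only [Fin.sum_univ_succ, Fin.cons_zero, Fin.cons_succ, norm_add_sq_real, iidExp_add, ih,
      iidExp_const hp, smul_eq_mul, mul_add, Finset.sum_add_distrib, ← Finset.sum_mul, hp.2]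
    rw [cross]
    push_cast
    ring

/-- The variance of a vector-valued function is at most its second moment. -/
lemma sum_mul_norm_sub_sq_le (hp : p ∈ stdSimplex ℝ M) {E : Type*} [NormedAddCommGroup E]
    [InnerProductSpace ℝ E] (Y : M → E) :
    ∑ m, p m * ‖Y m - ∑ m', p m' • Y m'‖ ^ 2 ≤ ∑ m, p m * ‖Y m‖ ^ 2 := by
  set μ := ∑ m', p m' • Y m' with hμ
  have h : ∑ m, p m * (2 * inner ℝ (Y m) μ) = 2 * ‖μ‖ ^ 2 := by
    rw [← real_inner_self_eq_norm_sq, hμ, sum_inner, Finset.mul_sum, ← hμ]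
    exact Finset.sum_congr rfl fun m _ => by rw [real_inner_smul_left]; ring
  simp only [norm_sub_sq_real, mul_add, mul_sub, Finset.sum_add_distrib, Finset.sum_sub_distrib,
    h, ← Finset.sum_mul, hp.2]
  nlinarith [sq_nonneg ‖μ‖]

/-- Hoeffding's lemma for a finite distribution, with a non-optimal constant. -/
lemma sum_mul_exp_le (hp : p ∈ stdSimplex ℝ M) {g : M → ℝ} {c : ℝ} (hc : 0 < c)
    (hg : ∀ m m', |g m - g m'| ≤ c) (t : ℝ) :
    ∑ m, p m * Real.exp (t * g m) ≤ Real.exp (t * ∑ m, p m * g m + (t * c) ^ 2 / 2) := by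
  set μ := ∑ m, p m * g m with hμ
  have hdev : ∀ m, |(g m - μ) / c| ≤ 1 := by
    intro m
    have h : g m - μ = ∑ m', p m' * (g m - g m') := by
      simp only [mul_sub, Finset.sum_sub_distrib, ← Finset.sum_mul, hp.2, one_mul, hμ]
    rw [abs_div, abs_of_pos hc, div_le_one hc, h]
    calc |∑ m', p m' * (g m - g m')| ≤ ∑ m', |p m' * (g m - g m')| :=
          Finset.abs_sum_le_sum_abs _ _
      _ ≤ ∑ m', p m' * c := Finset.sum_le_sum fun m' _ => by
          rw [abs_mul, abs_of_nonneg (hp.1 m')]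
          exact mul_le_mul_of_nonneg_left (hg m m') (hp.1 m')
      _ = c := by rw [← Finset.sum_mul, hp.2, one_mul]
  have h0 : ∑ m, p m * ((g m - μ) / c) = 0 := by
    simp only [mul_div_assoc', mul_sub]
    rw [← Finset.sum_div, Finset.sum_sub_distrib, ← Finset.sum_mul, hp.2, ← hμ]
    simp
  calc ∑ m, p m * Real.exp (t * g m)
      = Real.exp (t * μ) * ∑ m, p m * Real.exp ((g m - μ) / c * (t * c)) := by
        rw [Finset.mul_sum]
        refine Finset.sum_congr rfl fun m _ => ?_
        rw [mul_left_comm, ← Real.exp_add]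
        congr 2
        field_simp
        ring
    _ ≤ Real.exp (t * μ) * ∑ m, p m *
          (Real.cosh (t * c) + (g m - μ) / c * Real.sinh (t * c)) := by
        gcongr with m
        · exact hp.1 m
        · exact Real.exp_mul_le_cosh_add_mul_sinh (hdev m) _
    _ = Real.exp (t * μ) * Real.cosh (t * c) := by
        simp only [mul_add, ← mul_assoc, Finset.sum_add_distrib, ← Finset.sum_mul, hp.2, h0]
        ring
    _ ≤ Real.exp (t * μ) * Real.exp ((t * c) ^ 2 / 2) := by
        gcongr
        exact Real.cosh_le_exp_half_sq _
    _ = _ := by rw [← Real.exp_add]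

/-- The exponential moment bound behind McDiarmid's inequality: a function of `n` independent
samples that moves by at most `c` when one sample changes is sub-Gaussian. The bound follows by
averaging out one sample at a time. -/
lemma iidExp_exp_le [DecidableEq M] (hp : p ∈ stdSimplex ℝ M) {c : ℝ} (hc : 0 < c) (t : ℝ)
    (n : ℕ) (f : (Fin n → M) → ℝ)
    (hf : ∀ x i m, |f (Function.update x i m) - f x| ≤ c) :
    (iidExp p fun x => Real.exp (t * f x)) ≤
      Real.exp (t * iidExp p f + n * ((t * c) ^ 2 / 2)) := by
  induction n with
  | zero => simp [iidExp_zero]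
  | succ n ih =>
    set g : M → ℝ := fun m => iidExp p fun y : Fin n → M => f (Fin.cons m y) with hg
    have hslice : ∀ m, (iidExp p fun y : Fin n → M => Real.exp (t * f (Fin.cons m y))) ≤
        Real.exp (t * g m + n * ((t * c) ^ 2 / 2)) := by
      intro m
      refine ih (fun y => f (Fin.cons m y)) fun y i m' => ?_
      rw [Fin.cons_update]
      exact hf _ _ _
    have hgc : ∀ m m', |g m - g m'| ≤ c := by
      have hle : ∀ m m', g m - g m' ≤ c := by
        intro m m'
        rw [hg, ← iidExp_sub]
        refine (iidExp_mono hp (g := fun _ => c) fun y => ?_).trans_eq (iidExp_const hp n c)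
        have := hf (Fin.cons m' y) 0 m
        rw [Fin.update_cons_zero] at this
        exact (le_abs_self _).trans this
      intro m m'
      exact abs_le.2 ⟨by linarith [hle m' m], hle m m'⟩
    rw [iidExp_succ, iidExp_succ p f]
    calc ∑ m, p m • iidExp p (fun y : Fin n → M => Real.exp (t * f (Fin.cons m y)))
        ≤ ∑ m, p m * Real.exp (t * g m + n * ((t * c) ^ 2 / 2)) :=
          Finset.sum_le_sum fun m _ => mul_le_mul_of_nonneg_left (hslice m) (hp.1 m)
      _ = (∑ m, p m * Real.exp (t * g m)) * Real.exp (n * ((t * c) ^ 2 / 2)) := by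
          rw [Finset.sum_mul]
          exact Finset.sum_congr rfl fun m _ => by rw [Real.exp_add, mul_assoc]
      _ ≤ Real.exp (t * ∑ m, p m * g m + (t * c) ^ 2 / 2) * Real.exp (n * ((t * c) ^ 2 / 2)) := by
          gcongr
          exact sum_mul_exp_le hp hc hgc t
      _ = _ := by
          rw [← Real.exp_add]
          congr 1
          simp only [smul_eq_mul]
          push_cast
          ring

variable [MeasurableSpace M] [MeasurableSingletonClass M]
  {Ω : Type*} [MeasurableSpace Ω] {P : Measure Ω} [IsProbabilityMeasure P]

lemma measureReal_eq_iidExp {n : ℕ} {X : Fin n → Ω → M} (hX : ∀ i, Measurable (X i))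
    (h_law : ∀ i m, P.real {ω | X i ω = m} = p m) (h_indep : iIndepFun X P)
    (s : Set (Fin n → M)) [DecidablePred (· ∈ s)] :
    P.real {ω | (fun i => X i ω) ∈ s} = iidExp p fun x => if x ∈ s then (1 : ℝ) else 0 := by
  classical
  have hXm : Measurable fun ω i => X i ω := measurable_pi_lambda _ hX
  have hsing : ∀ x : Fin n → M, P.real {ω | (fun i => X i ω) = x} = ∏ i, p (x i) := by
    intro x
    have h := h_indep.measure_inter_preimage_eq_mul Finset.univ (sets := fun i => {x i})
      fun i _ => measurableSet_singleton _
    have e : {ω | (fun i => X i ω) = x} = ⋂ i ∈ (Finset.univ : Finset (Fin n)),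
        X i ⁻¹' {x i} := by
      ext ω
      simp [funext_iff]
    rw [measureReal_def, e, h, ENNReal.toReal_prod]
    exact Finset.prod_congr rfl fun i _ => h_law i (x i)
  have e : {ω | (fun i => X i ω) ∈ s} = ⋃ x ∈ Finset.univ.filter (· ∈ s),
      {ω | (fun i => X i ω) = x} := by
    ext ω
    simp
  rw [e, measureReal_biUnion_finset]
  · simp only [hsing, iidExp, smul_eq_mul, mul_ite, mul_one, mul_zero, Finset.sum_filter]
  · intro x _ y _ hxy
    exact Set.disjoint_left.2 fun ω h1 h2 => hxy (h1.symm.trans h2)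
  · exact fun x _ => hXm (measurableSet_singleton x)

/-- McDiarmid's bounded differences inequality, with a non-optimal constant. -/
lemma one_sub_exp_le_measureReal_le [DecidableEq M] (hp : p ∈ stdSimplex ℝ M) {n : ℕ} (hn : 0 < n)
    {X : Fin n → Ω → M} (hX : ∀ i, Measurable (X i))
    (h_law : ∀ i m, P.real {ω | X i ω = m} = p m) (h_indep : iIndepFun X P)
    {f : (Fin n → M) → ℝ} {c : ℝ} (hc : 0 < c)
    (hf : ∀ x i m, |f (Function.update x i m) - f x| ≤ c) {t : ℝ} (ht : 0 ≤ t) :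
    1 - Real.exp (-(t ^ 2 / (2 * n * c ^ 2))) ≤
      P.real {ω | f (fun i => X i ω) ≤ iidExp p f + t} := by
  classical
  have hn' : (0 : ℝ) < n := by exact_mod_cast hn
  -- The exponent minimizing `-a t + n (a c)² / 2`.
  set a : ℝ := t / (n * c ^ 2) with ha
  have ha0 : 0 ≤ a := by positivity
  have h1 := measureReal_eq_iidExp hX h_law h_indep {x | f x ≤ iidExp p f + t}
  -- The exponential Markov inequality, as a pointwise bound on the indicator of the event.
  have hmarkov : ∀ x, 1 - Real.exp (-(a * (iidExp p f + t))) * Real.exp (a * f x) ≤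
      if x ∈ {x | f x ≤ iidExp p f + t} then (1 : ℝ) else 0 := by
    intro x
    rw [← Real.exp_add]
    split_ifs with hx
    · linarith [Real.exp_pos (-(a * (iidExp p f + t)) + a * f x)]
    · have hx' : iidExp p f + t < f x := not_le.1 hx
      have : 0 ≤ -(a * (iidExp p f + t)) + a * f x := by nlinarith
      linarith [Real.one_le_exp this]
  have h2 := iidExp_mono hp hmarkov
  rw [← h1, iidExp_sub, iidExp_const hp, iidExp_const_mul] at h2
  refine le_trans ?_ h2
  have h3 := iidExp_exp_le hp hc a n f hf
  have h4 : Real.exp (-(a * (iidExp p f + t))) * (iidExp p fun x => Real.exp (a * f x)) ≤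
      Real.exp (-(t ^ 2 / (2 * n * c ^ 2))) := by
    refine (mul_le_mul_of_nonneg_left h3 (Real.exp_pos _).le).trans_eq ?_
    rw [← Real.exp_add]
    congr 1
    rw [ha]
    field_simp
    ring
  linarith

end IID

/-! ### States cut down by two projections -/

section Covering

variable {V : Type*} [NormedAddCommGroup V] [InnerProductSpace ℂ V]

/-- The state `ρ` cut down by the projection `F` and then by the projection `E`. -/
noncomputable def cutDown (E F ρ : V →L[ℂ] V) : V →L[ℂ] V := E * F * ρ * F * E

lemma cutDown_eq (E F ρ : V →L[ℂ] V) : cutDown E F ρ = E * (F * ρ * F) * E := by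
  simp only [cutDown, mul_assoc]

variable [CompleteSpace V]

lemma mul_cutDown {E : V →L[ℂ] V} (hE : IsStarProjection E) (F ρ : V →L[ℂ] V) :
    E * cutDown E F ρ = cutDown E F ρ := by
  simp only [cutDown, ← mul_assoc, hE.isIdempotentElem.eq]

lemma cutDown_nonneg {E F ρ : V →L[ℂ] V} (hE : IsStarProjection E) (hF : IsStarProjection F)
    (hρ : IsState ρ) : 0 ≤ cutDown E F ρ := by
  rw [cutDown_eq]
  exact nonneg_conj hE (nonneg_conj hF hρ.1)

variable [FiniteDimensional ℂ V]

lemma re_trace_cutDown_le {E F ρ : V →L[ℂ] V} (hE : IsStarProjection E) (hF : IsStarProjection F)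
    (hρ : IsState ρ) : (trace (cutDown E F ρ)).re ≤ 1 := by
  rw [cutDown_eq]
  refine (re_trace_conj_le hE (nonneg_conj hF hρ.1)).trans ((re_trace_conj_le hF hρ.1).trans ?_)
  rw [hρ.2, Complex.one_re]

/-- Gentle measurement for two projections in succession. -/
lemma traceNorm_cutDown_sub_le {E F ρ : V →L[ℂ] V} (hE : IsStarProjection E)
    (hF : IsStarProjection F) (hρ : IsState ρ) {ε : ℝ} (h1 : 1 - ε ≤ (trace (ρ * E)).re)
    (h2 : 1 - ε ≤ (trace (ρ * F)).re) : traceNorm (cutDown E F ρ - ρ) ≤ 4 * √ε := by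
  have hsa := hρ.1.isSelfAdjoint
  have e : cutDown E F ρ - ρ = -((ρ - E * ρ * E) + E * (ρ - F * ρ * F) * E) := by
    rw [cutDown_eq]
    noncomm_ring
  rw [e, traceNorm_neg]
  have hFsa := hsa.sub (isSelfAdjoint_conj hF hsa)
  have := traceNorm_add_le (hsa.sub (isSelfAdjoint_conj hE hsa)) (isSelfAdjoint_conj hE hFsa)
  have := traceNorm_conj_le hE hFsa
  have := traceNorm_sub_conj_le hρ hE h1
  have := traceNorm_sub_conj_le hρ hF h2
  linarith

lemma re_trace_le_traceNorm {A : V →L[ℂ] V} (hA : IsSelfAdjoint A) :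
    (trace A).re ≤ traceNorm A := by
  refine le_trans ?_ (sum_abs_inner_le_traceNorm (stdOrthonormalBasis ℂ V) hA)
  rw [re_trace_eq_sum (stdOrthonormalBasis ℂ V)]
  exact Finset.sum_le_sum fun i _ => le_abs_self _

/-- A state that is flat at level `1 / d` under `F` and nearly contained in `E` forces the rank
of `E` to be at least about `d`. -/
lemma one_sub_le_trace_div {E F ρ : V →L[ℂ] V} (hE : IsStarProjection E)
    (hF : IsStarProjection F) (hρ : IsState ρ) {ε d : ℝ} (hd : 0 < d)
    (h1 : 1 - ε ≤ (trace (ρ * E)).re) (h2 : 1 - ε ≤ (trace (ρ * F)).re)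
    (hflat : F * ρ * F ≤ ((1 / d : ℝ) : ℂ) • F) : 1 - 4 * √ε ≤ (trace E).re / d := by
  have hsa := hρ.1.isSelfAdjoint
  have hY := (cutDown_nonneg hE hF hρ).isSelfAdjoint
  have h3 := re_trace_le_traceNorm (hY.sub hsa).neg
  rw [traceNorm_neg, neg_sub, trace_sub, Complex.sub_re, hρ.2, Complex.one_re] at h3
  have h4 := traceNorm_cutDown_sub_le hE hF hρ h1 h2
  have h5 : (trace (cutDown E F ρ)).re ≤ (trace E).re / d := by
    rw [cutDown_eq, trace_conj hE, trace_mul_comm]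
    have hd' : 0 ≤ 1 / d := by positivity
    refine (re_trace_mul_mono hE.nonneg (hflat.trans (smul_le_smul_one hF hd'))).trans_eq ?_
    rw [mul_smul_comm, mul_one, trace_smul, Complex.re_ofReal_mul]
    ring
  linarith

/-- The mean trace-norm deviation of an empirical average of operators supported on the range of
`E`: at most the square root of rank times second moment over sample size. -/
lemma iidExp_traceNorm_sub_le {M : Type*} [Fintype M] {p : M → ℝ} (hp : p ∈ stdSimplex ℝ M)
    {E : V →L[ℂ] V} (hE : IsStarProjection E) {Y : M → V →L[ℂ] V}
    (hY : ∀ m, IsSelfAdjoint (Y m)) (hEY : ∀ m, E * Y m = Y m) {v : ℝ}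
    (hv : ∀ m, (trace (star (Y m) * Y m)).re ≤ v) {L : ℕ} (hL : 0 < L) :
    (iidExp p fun x : Fin L → M =>
      traceNorm ((((L : ℝ)⁻¹ : ℝ) : ℂ) • ∑ i, Y (x i) - ∑ m, (p m : ℂ) • Y m)) ≤
      √(trace E).re * √(v / L) := by
  have hL' : (0 : ℝ) < L := by exact_mod_cast hL
  have hLc : (L : ℂ) ≠ 0 := by exact_mod_cast hL.ne'
  let _ : InnerProductSpace ℝ V := InnerProductSpace.complexToReal
  set b := stdOrthonormalBasis ℂ V
  set μ := ∑ m, (p m : ℂ) • Y m with hμ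
  set B : (Fin L → M) → V →L[ℂ] V := fun x =>
    (((L : ℝ)⁻¹ : ℝ) : ℂ) • ∑ i, Y (x i) - μ with hB
  have hBsa : ∀ x, IsSelfAdjoint (B x) := fun x =>
    (isSelfAdjoint_real_smul _ (isSelfAdjoint_sum _ fun i _ => hY (x i))).sub
      (isSelfAdjoint_sum _ fun m _ => isSelfAdjoint_real_smul _ (hY m))
  have hEB : ∀ x, E * B x = B x := by
    intro x
    simp only [hB, hμ, mul_sub, mul_smul_comm, Finset.mul_sum, hEY]
  have hBZ : ∀ x j, ‖B x (b j)‖ ^ 2 =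
      ((L : ℝ)⁻¹) ^ 2 * ‖∑ i, (Y (x i) (b j) - μ (b j))‖ ^ 2 := by
    intro x j
    have : B x (b j) = (((L : ℝ)⁻¹ : ℝ) : ℂ) • ∑ i, (Y (x i) (b j) - μ (b j)) := by
      simp only [hB, Finset.sum_sub_distrib, Finset.sum_const, Finset.card_univ, Fintype.card_fin,
        sub_apply, smul_apply, sum_apply, smul_sub]
      congr 1
      rw [← Nat.cast_smul_eq_nsmul ℂ, smul_smul]
      push_cast
      rw [inv_mul_cancel₀ hLc, one_smul]
    rw [this, norm_smul, mul_pow]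
    simp
  have hmean : ∀ j, ∑ m, p m • Y m (b j) = μ (b j) := by
    intro j
    simp only [hμ, sum_apply, smul_apply, Complex.coe_smul]
  have hvar : ∀ j, (iidExp p fun x => ‖B x (b j)‖ ^ 2) ≤
      (L : ℝ)⁻¹ * ∑ m, p m * ‖Y m (b j)‖ ^ 2 := by
    intro j
    simp only [hBZ]
    rw [iidExp_const_mul, iidExp_norm_sum_sq hp (fun m => Y m (b j) - μ (b j))]
    · have hle := sum_mul_norm_sub_sq_le hp (fun m => Y m (b j))
      rw [hmean] at hle
      calc ((L : ℝ)⁻¹) ^ 2 * (L * ∑ m, p m * ‖Y m (b j) - μ (b j)‖ ^ 2)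
          = (L : ℝ)⁻¹ * ∑ m, p m * ‖Y m (b j) - μ (b j)‖ ^ 2 := by field_simp
        _ ≤ _ := by gcongr
    · simp only [smul_sub, Finset.sum_sub_distrib, hmean, ← Finset.sum_smul, hp.2, one_smul,
        sub_self]
  have hHS : (iidExp p fun x => (trace (star (B x) * B x)).re) ≤ v / L := by
    simp only [re_trace_star_mul_self b]
    rw [iidExp_sum]
    calc ∑ j, (iidExp p fun x => ‖B x (b j)‖ ^ 2)
        ≤ ∑ j, (L : ℝ)⁻¹ * ∑ m, p m * ‖Y m (b j)‖ ^ 2 := Finset.sum_le_sum fun j _ => hvar j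
      _ = (L : ℝ)⁻¹ * ∑ m, p m * (trace (star (Y m) * Y m)).re := by
        simp only [re_trace_star_mul_self b, ← Finset.mul_sum]
        rw [Finset.sum_comm]
        simp only [Finset.mul_sum]
      _ ≤ (L : ℝ)⁻¹ * ∑ m, p m * v := by
        gcongr with m
        · exact hp.1 m
        · exact hv m
      _ = v / L := by
        rw [← Finset.sum_mul, hp.2]
        ring
  calc (iidExp p fun x => traceNorm (B x))
      ≤ iidExp p fun x => √(trace E).re * √(trace (star (B x) * B x)).re :=
        iidExp_mono hp fun x => traceNorm_le_sqrt_mul_sqrt hE (hBsa x) (hEB x)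
    _ = √(trace E).re * iidExp p fun x => √(trace (star (B x) * B x)).re :=
        iidExp_const_mul _ _ _
    _ ≤ √(trace E).re * √(v / L) := by
        gcongr
        refine (iidExp_le_sqrt hp fun x => Real.sqrt_nonneg _).trans (Real.sqrt_le_sqrt ?_)
        refine le_of_eq_of_le ?_ hHS
        congr 1
        funext x
        rw [Real.sq_sqrt]
        rw [re_trace_star_mul_self b]
        positivity

end Covering

/-! ### Deviation of the empirical average -/

section Deviation

variable {V : Type*} [NormedAddCommGroup V] [InnerProductSpace ℂ V] [CompleteSpace V]
  {M : Type*}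

lemma traceNorm_average_le {Y : M → V →L[ℂ] V} (hY : ∀ m, 0 ≤ Y m)
    (hY1 : ∀ m, (trace (Y m)).re ≤ 1) {L : ℕ} (hL : 0 < L) (x : Fin L → M) :
    traceNorm ((((L : ℝ)⁻¹ : ℝ) : ℂ) • ∑ j, Y (x j)) ≤ 1 := by
  have hL' : (0 : ℝ) < L := by exact_mod_cast hL
  rw [traceNorm_real_smul (by positivity), traceNorm_of_nonneg
    (Finset.sum_nonneg fun j _ => hY (x j)), trace_sum, Complex.re_sum]
  calc (L : ℝ)⁻¹ * ∑ j, (trace (Y (x j))).re ≤ (L : ℝ)⁻¹ * ∑ _j : Fin L, 1 := by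
        gcongr with j
        exact hY1 (x j)
    _ = 1 := by simp [hL'.ne']

variable [FiniteDimensional ℂ V]

/-- Changing one sample moves the trace-norm distance of an empirical average of subnormalized
states from a fixed operator by at most `2 / L`. -/
lemma abs_traceNorm_update_sub_le [DecidableEq M] {Y : M → V →L[ℂ] V} (hY : ∀ m, 0 ≤ Y m)
    (hY1 : ∀ m, (trace (Y m)).re ≤ 1) {L : ℕ} (hL : 0 < L) {T : V →L[ℂ] V} (hT : IsSelfAdjoint T)
    (x : Fin L → M) (i : Fin L) (m : M) :
    |traceNorm ((((L : ℝ)⁻¹ : ℝ) : ℂ) • ∑ j, Y (Function.update x i m j) - T) -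
      traceNorm ((((L : ℝ)⁻¹ : ℝ) : ℂ) • ∑ j, Y (x j) - T)| ≤ 2 / L := by
  set c : ℝ := (L : ℝ)⁻¹ with hc
  have hc0 : 0 ≤ c := by positivity
  have hsa : ∀ x : Fin L → M, IsSelfAdjoint ((c : ℂ) • ∑ j, Y (x j) - T) := fun x =>
    (isSelfAdjoint_real_smul _ (isSelfAdjoint_sum _ fun j _ => (hY (x j)).isSelfAdjoint)).sub hT
  set A := (c : ℂ) • ∑ j, Y (Function.update x i m j) - T with hA
  set B := (c : ℂ) • ∑ j, Y (x j) - T with hB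
  have hsum : ∑ j, Y (Function.update x i m j) - ∑ j, Y (x j) = Y m - Y (x i) := by
    rw [← Finset.sum_sub_distrib, Finset.sum_eq_single i]
    · simp
    · intro j _ hj
      simp [hj]
    · simp
  have hAB : A - B = (c : ℂ) • (Y m - Y (x i)) := by
    rw [hA, hB, sub_sub_sub_cancel_right, ← smul_sub, hsum]
  have hd : traceNorm (A - B) ≤ 2 / L := by
    rw [hAB, traceNorm_real_smul hc0]
    have h := traceNorm_sub_le (hY m).isSelfAdjoint (hY (x i)).isSelfAdjoint
    rw [traceNorm_of_nonneg (hY m), traceNorm_of_nonneg (hY (x i))] at h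
    have h2 : traceNorm (Y m - Y (x i)) ≤ 2 := by linarith [hY1 m, hY1 (x i)]
    calc c * traceNorm (Y m - Y (x i)) ≤ c * 2 := by gcongr
      _ = 2 / L := by rw [hc]; ring
  have h1 := traceNorm_add_le (hsa x) ((hsa (Function.update x i m)).sub (hsa x))
  have h2 := traceNorm_sub_le (hsa (Function.update x i m))
    ((hsa (Function.update x i m)).sub (hsa x))
  rw [← hA, ← hB] at h1 h2
  rw [add_sub_cancel] at h1
  rw [sub_sub_cancel] at h2
  rw [abs_le]
  constructor <;> linarith

lemma traceNorm_mixture_le {ρ : M → V →L[ℂ] V} (hρ : ∀ m, IsState (ρ m)) {p : M → ℝ}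
    (hp : ∀ m, 0 ≤ p m) (s : Finset M) :
    traceNorm (∑ m ∈ s, (p m : ℂ) • ρ m) ≤ ∑ m ∈ s, p m := by
  refine (traceNorm_sum_le s fun m =>
    isSelfAdjoint_real_smul _ (hρ m).1.isSelfAdjoint).trans (Finset.sum_le_sum fun m _ => ?_)
  rw [traceNorm_real_smul (hp m), traceNorm_of_nonneg (hρ m).1, (hρ m).2, Complex.one_re, mul_one]

variable [Fintype M]

/-- The mean trace-norm distance between the empirical average of cut-down states and the ideal
mixture. The three contributions are the samples outside `s`, the statistical fluctuation of
the samples inside `s`, and the disturbance caused by the projections. -/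
lemma iidExp_traceNorm_cutDown_le {p : M → ℝ} (hp : p ∈ stdSimplex ℝ M) (s : Finset M)
    {ρ : M → V →L[ℂ] V} (hρ : ∀ m, IsState (ρ m)) {E : V →L[ℂ] V} (hE : IsStarProjection E)
    {F : M → V →L[ℂ] V} (hF : ∀ m, IsStarProjection (F m)) {ε d : ℝ} (hd : 0 < d)
    (h1 : ∀ m ∈ s, 1 - ε ≤ (trace (ρ m * E)).re) (h2 : ∀ m ∈ s, 1 - ε ≤ (trace (ρ m * F m)).re)
    (hflat : ∀ m ∈ s, F m * ρ m * F m ≤ ((1 / d : ℝ) : ℂ) • F m) {L : ℕ} (hL : 0 < L) :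
    (iidExp p fun x : Fin L → M => traceNorm ((((L : ℝ)⁻¹ : ℝ) : ℂ) •
      ∑ i, cutDown E (F (x i)) (ρ (x i)) - ∑ m ∈ s, (p m : ℂ) • ρ m)) ≤
      (1 - ∑ m ∈ s, p m) + √(trace E).re * √(1 / d / L) + 4 * √ε := by
  classical
  have hL' : (0 : ℝ) < L := by exact_mod_cast hL
  have hd' : 0 ≤ 1 / d := by positivity
  set c : ℝ := (L : ℝ)⁻¹ with hc
  have hc0 : 0 ≤ c := by positivity
  set Y : M → V →L[ℂ] V := fun m => cutDown E (F m) (ρ m) with hYdef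
  have hY : ∀ m, 0 ≤ Y m := fun m => cutDown_nonneg hE (hF m) (hρ m)
  have hY1 : ∀ m, (trace (Y m)).re ≤ 1 := fun m => re_trace_cutDown_le hE (hF m) (hρ m)
  -- `Y₁` keeps the operators with index in `s`, where the states are flat; `Y₂` keeps the rest.
  set Y₁ : M → V →L[ℂ] V := fun m => if m ∈ s then Y m else 0 with hY₁def
  set Y₂ : M → V →L[ℂ] V := fun m => if m ∈ s then 0 else Y m with hY₂def
  have hY₁ : ∀ m, 0 ≤ Y₁ m := fun m => by
    simp only [hY₁def]; split_ifs; exacts [hY m, le_rfl]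
  have hY₂ : ∀ m, 0 ≤ Y₂ m := fun m => by
    simp only [hY₂def]; split_ifs; exacts [le_rfl, hY m]
  have hY12 : ∀ m, Y m = Y₁ m + Y₂ m := fun m => by
    simp only [hY₁def, hY₂def]; split_ifs <;> simp
  set out : M → ℝ := fun m => if m ∈ s then 0 else 1 with hout
  have hY₂t : ∀ m, (trace (Y₂ m)).re ≤ out m := fun m => by
    simp only [hY₂def, hout]; split_ifs
    exacts [by simp [trace], hY1 m]
  set μ := ∑ m, (p m : ℂ) • Y₁ m with hμ
  have hμs : μ = ∑ m ∈ s, (p m : ℂ) • Y m := by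
    simp [hμ, hY₁def, Finset.sum_ite_mem]
  have hμsa : IsSelfAdjoint μ :=
    isSelfAdjoint_sum _ fun m _ => isSelfAdjoint_real_smul _ (hY₁ m).isSelfAdjoint
  set T := ∑ m ∈ s, (p m : ℂ) • ρ m with hT
  have hTsa : IsSelfAdjoint T :=
    isSelfAdjoint_sum _ fun m _ => isSelfAdjoint_real_smul _ (hρ m).1.isSelfAdjoint
  have hps : ∑ m ∈ s, p m ≤ 1 := by
    rw [← hp.2]
    exact Finset.sum_le_sum_of_subset_of_nonneg s.subset_univ fun m _ _ => hp.1 m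
  have hmean : traceNorm (μ - T) ≤ 4 * √ε := by
    rw [hμs, hT, ← Finset.sum_sub_distrib]
    simp only [← smul_sub]
    refine (traceNorm_sum_le s fun m => isSelfAdjoint_real_smul _
      ((hY m).isSelfAdjoint.sub (hρ m).1.isSelfAdjoint)).trans ?_
    calc ∑ m ∈ s, traceNorm ((p m : ℂ) • (Y m - ρ m)) ≤ ∑ m ∈ s, p m * (4 * √ε) := by
          refine Finset.sum_le_sum fun m hm => ?_
          rw [traceNorm_real_smul (hp.1 m)]
          exact mul_le_mul_of_nonneg_left
            (traceNorm_cutDown_sub_le hE (hF m) (hρ m) (h1 m hm) (h2 m hm)) (hp.1 m)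
      _ = (∑ m ∈ s, p m) * (4 * √ε) := by rw [Finset.sum_mul]
      _ ≤ 1 * (4 * √ε) := by gcongr
      _ = 4 * √ε := one_mul _
  have hfluct := iidExp_traceNorm_sub_le hp hE (Y := Y₁) (fun m => (hY₁ m).isSelfAdjoint)
    (fun m => by
      simp only [hY₁def]; split_ifs
      exacts [mul_cutDown hE _ _, mul_zero _])
    (v := 1 / d) (fun m => by
      simp only [hY₁def]; split_ifs with hm
      · refine re_trace_star_mul_self_le (hY m) hd' ?_ (hY1 m)
        simp only [hYdef, cutDown_eq]
        exact conj_le_smul_one hE hd' ((hflat m hm).trans (smul_le_smul_one (hF m) hd'))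
      · simpa [trace] using hd.le) hL
  have hpt : ∀ x : Fin L → M, traceNorm ((c : ℂ) • ∑ i, Y (x i) - T) ≤
      traceNorm ((c : ℂ) • ∑ i, Y₁ (x i) - μ) + c * ∑ i, out (x i) + 4 * √ε := by
    intro x
    have e : (c : ℂ) • ∑ i, Y (x i) - T =
        ((c : ℂ) • ∑ i, Y₁ (x i) - μ) + (c : ℂ) • ∑ i, Y₂ (x i) + (μ - T) := by
      simp only [hY12, Finset.sum_add_distrib, smul_add]
      abel
    have hs1 : IsSelfAdjoint ((c : ℂ) • ∑ i, Y₁ (x i) - μ) := (isSelfAdjoint_real_smul _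
      (isSelfAdjoint_sum _ fun i _ => (hY₁ (x i)).isSelfAdjoint)).sub hμsa
    have hs2 : IsSelfAdjoint ((c : ℂ) • ∑ i, Y₂ (x i)) := isSelfAdjoint_real_smul _
      (isSelfAdjoint_sum _ fun i _ => (hY₂ (x i)).isSelfAdjoint)
    have h3 := traceNorm_add_le (hs1.add hs2) (hμsa.sub hTsa)
    have h4 := traceNorm_add_le hs1 hs2
    have h5 : traceNorm ((c : ℂ) • ∑ i, Y₂ (x i)) ≤ c * ∑ i, out (x i) := by
      rw [traceNorm_real_smul hc0, traceNorm_of_nonneg (Finset.sum_nonneg fun i _ => hY₂ (x i)),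
        trace_sum, Complex.re_sum]
      gcongr with i
      exact hY₂t (x i)
    rw [e]
    linarith
  refine (iidExp_mono hp hpt).trans ?_
  rw [iidExp_add, iidExp_add, iidExp_const_mul, iidExp_sum_apply hp, iidExp_const hp]
  have hout' : ∑ m, p m * out m = 1 - ∑ m ∈ s, p m := by
    have : ∀ m, p m * out m = p m - if m ∈ s then p m else 0 := fun m => by
      simp only [hout]; split_ifs <;> simp
    simp only [this, Finset.sum_sub_distrib, hp.2, Finset.sum_ite_mem, Finset.univ_inter]
  rw [hout', hc, inv_mul_cancel_left₀ hL'.ne']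
  linarith

end Deviation

/-- When the sample size `a`, in units of rank over flatness, is too small for the fluctuation
bound, the claimed tail bound exceeds `1`. -/
lemma one_le_two_mul_exp {s D a r : ℝ} (hs0 : 0 < s) (hs : s ≤ 1 / 21) (hD : 1 - s ^ 8 ≤ D)
    (ha : a * s ^ 2 < 1) (hr : r ≤ s ^ 24 * a) : 1 ≤ 2 * D * Real.exp (-r) := by
  have hs2 : s ^ 2 ≤ 1 / 4 := by nlinarith
  have hs8 : s ^ 8 ≤ 1 / 4 := by
    calc s ^ 8 ≤ s ^ 2 := pow_le_pow_of_le_one hs0.le (by linarith) (by norm_num)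
      _ ≤ 1 / 4 := hs2
  have hs22 : s ^ 22 ≤ 1 / 4 := by
    calc s ^ 22 ≤ s ^ 2 := pow_le_pow_of_le_one hs0.le (by linarith) (by norm_num)
      _ ≤ 1 / 4 := hs2
  have hr' : r ≤ 1 / 4 := by
    calc r ≤ s ^ 24 * a := hr
      _ = s ^ 22 * (a * s ^ 2) := by ring
      _ ≤ s ^ 22 * 1 := by gcongr
      _ ≤ 1 / 4 := by linarith
  have he : 3 / 4 ≤ Real.exp (-r) := by linarith [Real.add_one_le_exp (-r)]
  nlinarith

end QCover

/-! ### The covering bound -/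

theorem mainTheorem8
    {V : Type*} [NormedAddCommGroup V] [InnerProductSpace ℂ V] [CompleteSpace V]
    [FiniteDimensional ℂ V]
    {M : Type*} [Fintype M] [MeasurableSpace M] [MeasurableSingletonClass M]
    -- the subset `M'`, the ensemble of states and the probability distribution on `M`
    (M' : Finset M) (ρ : M → (V →L[ℂ] V)) (hρ : ∀ m, QCover.IsState (ρ m))
    (p : M → ℝ) (hp : p ∈ stdSimplex ℝ M)
    -- the total projector `Q` and the codeword projectors `Qc m`
    (Q : V →L[ℂ] V) (hQ : IsStarProjection Q)
    (Qc : M → (V →L[ℂ] V)) (hQc : ∀ m, IsStarProjection (Qc m))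
    (ε D d : ℝ) (hε0 : 0 < ε) (hε1 : ε < 1) (hD : 0 < D) (hd : 0 < d)
    (h_total : ∀ m ∈ M', 1 - ε ≤ (QCover.trace (ρ m * Q)).re)
    (h_code : ∀ m ∈ M', 1 - ε ≤ (QCover.trace (ρ m * Qc m)).re)
    (h_size : (QCover.trace Q).re ≤ D)
    (h_flat : ∀ m ∈ M', Qc m * ρ m * Qc m ≤ ((1 / d : ℝ) : ℂ) • Qc m)
    -- `L` independent indices `X i`, each with distribution `p`
    {Ω : Type*} [MeasurableSpace Ω] (P : Measure Ω) [IsProbabilityMeasure P]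
    (L : ℕ) (hL : 0 < L) (X : Fin L → Ω → M) (hX : ∀ i, Measurable (X i))
    (h_law : ∀ i m, P.real {ω | X i ω = m} = p m)
    (h_indep : iIndepFun X P) :
    1 - 2 * D * Real.exp (-((∑ m ∈ M', p m) * (ε ^ 3 * L * d / (2 * Real.log 2 * D)))) ≤
      P.real {ω |
        QCover.traceNorm
            (((L : ℂ)⁻¹ • ∑ i, Q * Qc (X i ω) * ρ (X i ω) * Qc (X i ω) * Q)
              - ∑ m ∈ M', (p m : ℂ) • ρ m)
          ≤ 1 - (∑ m ∈ M', p m) + 4 * √(1 - ∑ m ∈ M', p m) + 42 * ε ^ (1 / 8 : ℝ)} := by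
  classical
  have hL' : (0 : ℝ) < L := by exact_mod_cast hL
  set q := ∑ m ∈ M', p m with hq
  have hq0 : 0 ≤ q := Finset.sum_nonneg fun m _ => hp.1 m
  have hq1 : q ≤ 1 := by
    rw [hq, ← hp.2]
    exact Finset.sum_le_sum_of_subset_of_nonneg M'.subset_univ fun m _ _ => hp.1 m
  set s := ε ^ (1 / 8 : ℝ) with hs
  have hs0 : 0 < s := Real.rpow_pos_of_pos hε0 _
  have hs8 : s ^ 8 = ε := by
    rw [hs, ← Real.rpow_natCast, ← Real.rpow_mul hε0.le]
    norm_num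
  have hsqrt : √ε = s ^ 4 := by
    rw [← hs8, show s ^ 8 = (s ^ 4) ^ 2 by ring]
    exact Real.sqrt_sq (by positivity)
  set T := ∑ m ∈ M', (p m : ℂ) • ρ m with hT
  have hTsa : IsSelfAdjoint T :=
    isSelfAdjoint_sum _ fun m _ => QCover.isSelfAdjoint_real_smul _ (hρ m).1.isSelfAdjoint
  set Y : M → V →L[ℂ] V := fun m => QCover.cutDown Q (Qc m) (ρ m) with hYdef
  have hY : ∀ m, 0 ≤ Y m := fun m => QCover.cutDown_nonneg hQ (hQc m) (hρ m)
  have hY1 : ∀ m, (QCover.trace (Y m)).re ≤ 1 := fun m =>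
    QCover.re_trace_cutDown_le hQ (hQc m) (hρ m)
  set f : (Fin L → M) → ℝ := fun x =>
    QCover.traceNorm ((((L : ℝ)⁻¹ : ℝ) : ℂ) • ∑ i, Y (x i) - T) with hf
  set bound := 1 - q + 4 * √(1 - q) + 42 * s with hbound
  have hev : {ω | QCover.traceNorm
      (((L : ℂ)⁻¹ • ∑ i, Q * Qc (X i ω) * ρ (X i ω) * Qc (X i ω) * Q) - T) ≤ bound} =
      {ω | f (fun i => X i ω) ≤ bound} := by
    ext ω
    simp only [hf, hYdef, QCover.cutDown, Complex.ofReal_inv, Complex.ofReal_natCast]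
  rw [hev]
  set r := q * (ε ^ 3 * L * d / (2 * Real.log 2 * D)) with hr
  have hf_le : ∀ x, f x ≤ 1 + q := by
    intro x
    have h1 := QCover.traceNorm_sub_le (QCover.isSelfAdjoint_real_smul ((L : ℝ)⁻¹)
      (isSelfAdjoint_sum Finset.univ fun i _ => (hY (x i)).isSelfAdjoint)) hTsa
    have h2 := QCover.traceNorm_average_le hY hY1 hL x
    have h3 := QCover.traceNorm_mixture_le hρ hp.1 M'
    linarith
  -- The claim holds for every outcome once the radius reaches the largest value of `f`.
  have htriv : 1 + q ≤ bound → 1 - 2 * D * Real.exp (-r) ≤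
      P.real {ω | f (fun i => X i ω) ≤ bound} := by
    intro h
    have : {ω | f (fun i => X i ω) ≤ bound} = Set.univ :=
      Set.eq_univ_of_forall fun ω => (hf_le _).trans h
    rw [this, probReal_univ]
    have : 0 < 2 * D * Real.exp (-r) := by positivity
    linarith
  have hsq0 := Real.sqrt_nonneg (1 - q)
  rcases M'.eq_empty_or_nonempty with hM | ⟨m₀, hm₀⟩
  · apply htriv
    have : q = 0 := by rw [hq, hM, Finset.sum_empty]
    rw [hbound, this]
    norm_num
    linarith
  rcases lt_or_ge (1 / 21) s with hs1 | hs1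
  · apply htriv
    rw [hbound]
    linarith
  -- From here on `s = ε ^ (1 / 8)` is small; `a` is the sample size in units of `D / d`.
  have hs4 : s ^ 4 ≤ s ^ 1 / 8 := by
    have : s ^ 3 ≤ (1 / 21) ^ 3 := by gcongr
    nlinarith
  have hD1 : 1 - s ^ 8 ≤ D := by
    rw [hs8]
    have h1 := QCover.re_trace_mul_mono hQ.nonneg (hρ m₀).le_one
    rw [mul_one, QCover.trace_mul_comm] at h1
    linarith [h_total m₀ hm₀]
  have hDd : d ≤ 2 * D := by
    have h := QCover.one_sub_le_trace_div hQ (hQc m₀) (hρ m₀) hd (h_total m₀ hm₀)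
      (h_code m₀ hm₀) (h_flat m₀ hm₀)
    rw [hsqrt, le_div_iff₀ hd] at h
    nlinarith
  set a := L * d / D with ha
  have ha0 : 0 < a := by positivity
  have hrle : r ≤ s ^ 24 * a := by
    have hlog : 1 ≤ 2 * Real.log 2 := by linarith [Real.log_two_gt_d9]
    have e : ε ^ 3 * L * d / (2 * Real.log 2 * D) = s ^ 24 * a / (2 * Real.log 2) := by
      rw [← hs8, ha]
      field_simp
    rw [hr, e]
    have h0 : 0 ≤ s ^ 24 * a := by positivity
    calc q * (s ^ 24 * a / (2 * Real.log 2)) ≤ 1 * (s ^ 24 * a) := by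
          gcongr
          exact div_le_self h0 hlog
      _ = _ := one_mul _
  -- For `a s² < 1` the left-hand side is at most zero.
  rcases lt_or_ge (a * s ^ 2) 1 with has | has
  · have h := QCover.one_le_two_mul_exp hs0 hs1 hD1 has hrle
    linarith [measureReal_nonneg (μ := P) (s := {ω | f (fun i => X i ω) ≤ bound})]
  have hmean := QCover.iidExp_traceNorm_cutDown_le hp M' hρ hQ hQc hd h_total h_code h_flat hL
  have hfl : √(QCover.trace Q).re * √(1 / d / L) ≤ s := by
    rw [← Real.sqrt_mul' _ (by positivity)]
    apply Real.sqrt_le_iff.2 ⟨hs0.le, ?_⟩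
    calc (QCover.trace Q).re * (1 / d / L) ≤ D * (1 / d / L) := by gcongr
      _ = 1 / a := by rw [ha]; field_simp
      _ ≤ s ^ 2 := by rw [div_le_iff₀ ha0]; linarith
  have hmean' : QCover.iidExp p f + s ≤ bound := by
    rw [hsqrt] at hmean
    change QCover.iidExp p f ≤ _ at hmean
    rw [hbound]
    linarith
  have hc : (0 : ℝ) < 2 / L := by positivity
  have hmc := QCover.one_sub_exp_le_measureReal_le hp hL hX h_law h_indep (f := f) hc
    (fun x i m => QCover.abs_traceNorm_update_sub_le hY hY1 hL hTsa x i m) hs0.le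
  have hmono : P.real {ω | f (fun i => X i ω) ≤ QCover.iidExp p f + s} ≤
      P.real {ω | f (fun i => X i ω) ≤ bound} :=
    measureReal_mono fun ω hω => le_trans hω hmean'
  refine le_trans ?_ (hmc.trans hmono)
  have hexp : r ≤ s ^ 2 / (2 * L * (2 / L) ^ 2) := by
    have e : s ^ 2 / (2 * L * (2 / L) ^ 2) = s ^ 2 * (L / 8) := by
      field_simp
      ring
    have haL : a ≤ 2 * L := by
      rw [ha, div_le_iff₀ hD]
      nlinarith
    rw [e]
    have hs22 : s ^ 22 ≤ 1 / 16 := by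
      calc s ^ 22 ≤ s ^ 1 := pow_le_pow_of_le_one hs0.le (by linarith) (by norm_num)
        _ ≤ 1 / 16 := by linarith
    calc r ≤ s ^ 24 * a := hrle
      _ ≤ s ^ 24 * (2 * L) := by gcongr
      _ = s ^ 22 * (s ^ 2 * (2 * L)) := by ring
      _ ≤ 1 / 16 * (s ^ 2 * (2 * L)) := by gcongr
      _ = s ^ 2 * (L / 8) := by ring
  have hD2 : 1 ≤ 2 * D := by
    have : s ^ 8 ≤ s ^ 1 := pow_le_pow_of_le_one hs0.le (by linarith) (by norm_num)
    linarith
  have h1 : Real.exp (-(s ^ 2 / (2 * L * (2 / L) ^ 2))) ≤ Real.exp (-r) :=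
    Real.exp_le_exp.2 (neg_le_neg hexp)
  nlinarith [Real.exp_pos (-r)]
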